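/- Let $a\in\mathbb{C}$, $a\neq 0$, and let $F:\mathbb{C}^2\to\mathbb{C}^2$, $F(z,w)=(z^2,\,w^2+az)$. Let $\Omega$ be the immediate basin of attraction of the fixed point $(0,0)$, that is, the connected component containing $(0,0)$ of the set of points $x\in\mathbb{C}^2$ with $F^n(x)\to(0,0)$. For $x\in\Omega$ and $\xi\in\mathbb{C}^2$ put $$K_\Omega(x,\xi)=\inf\{r>0:\ \text{there is a holomorphic } f:\triangle\to\Omega \text{ with } f(0)=x,\ r f'(0)=\xi\},$$ where $\triangle$ is the unit disc in $\mathbb{C}$, and let $$d_\Omega(x,y)=\inf_\gamma\int_0^1 K_\Omega(\gamma(t),\gamma'(t))\,dt$$ be the Kobayashi distance on $\Omega$, the infimum being over all piecewise smooth curves $\gamma:[0,1]\to\Omega$ with $\gamma(0)=x$, $\gamma(1)=y$. Then there is $\varepsilon_0>0$, depending only on $a$, such that for every real $\varepsilon$ with $0<\varepsilon<\varepsilon_0$ and every $C>0$ there exists a point $(z_0,w_0)\in\Omega$ such that every $(\tilde z,\tilde w)\in\bigcup_{k\ge0}F^{-k}(\varepsilon,0)$ lies in $\Omega$ and satisfies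 $$d_\Omega\big((z_0,w_0),(\tilde z,\tilde w)\big)\ge C.$$ -/

import Mathlib

open Set Filter Topology MeasureTheory
open scoped ENNReal ContDiff

/-- The skew product `F(z, w) = (z², w² + a z)` on `ℂ²`. -/
def skewMap (a : ℂ) (p : ℂ × ℂ) : ℂ × ℂ :=
  (p.1 ^ 2, p.2 ^ 2 + a * p.1)

/-- The basin of attraction of `x₀`: the points whose forward orbit converges to `x₀`. -/
def attractingBasin (F : ℂ × ℂ → ℂ × ℂ) (x₀ : ℂ × ℂ) : Set (ℂ × ℂ) :=
  {x | Tendsto (fun n : ℕ => F^[n] x) atTop (𝓝 x₀)}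

/-- The immediate basin: the connected component of the basin that contains `x₀`. -/
def immediateBasin (F : ℂ × ℂ → ℂ × ℂ) (x₀ : ℂ × ℂ) : Set (ℂ × ℂ) :=
  connectedComponentIn (attractingBasin F x₀) x₀

/-- The infinitesimal Kobayashi metric of `Ω ⊆ ℂ²` at the point `x` in the direction `ξ`:
the infimum of all `r > 0` for which there is a holomorphic map `f` from the unit disc to `Ω`
with `f 0 = x` and `r f'(0) = ξ`. -/
noncomputable def kobayashiMetric (Ω : Set (ℂ × ℂ)) (x ξ : ℂ × ℂ) : ℝ≥0∞ :=
  sInf {s : ℝ≥0∞ | ∃ (r : ℝ) (f : ℂ → ℂ × ℂ), 0 < r ∧ s = ENNReal.ofReal r ∧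
    DifferentiableOn ℂ f (Metric.ball 0 1) ∧ MapsTo f (Metric.ball 0 1) Ω ∧
    f 0 = x ∧ (r : ℂ) • deriv f 0 = ξ}

/-- `γ`, restricted to `[0, 1]`, is a piecewise smooth curve: it is continuous, and there is a
finite partition of `[0, 1]` such that `γ` is smooth on each closed subinterval. -/
def PiecewiseSmooth (γ : ℝ → ℂ × ℂ) : Prop :=
  ContinuousOn γ (Icc 0 1) ∧
    ∃ (n : ℕ) (t : ℕ → ℝ), Monotone t ∧ t 0 = 0 ∧ t n = 1 ∧
      ∀ i < n, ContDiffOn ℝ ∞ γ (Icc (t i) (t (i + 1)))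

/-- The Kobayashi length of the curve `γ` on `[0, 1]`. The finitely many break points, where
`deriv γ` may be meaningless, do not contribute. -/
noncomputable def kobayashiLength (Ω : Set (ℂ × ℂ)) (γ : ℝ → ℂ × ℂ) : ℝ≥0∞ :=
  ∫⁻ t in Icc (0 : ℝ) 1, kobayashiMetric Ω (γ t) (deriv γ t)

/-- The Kobayashi distance on `Ω`: the infimum of the Kobayashi lengths of the piecewise smooth
curves in `Ω` from `x` to `y`. -/
noncomputable def kobayashiDist (Ω : Set (ℂ × ℂ)) (x y : ℂ × ℂ) : ℝ≥0∞ :=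
  sInf {L : ℝ≥0∞ | ∃ γ : ℝ → ℂ × ℂ, PiecewiseSmooth γ ∧ MapsTo γ (Icc 0 1) Ω ∧
    γ 0 = x ∧ γ 1 = y ∧ L = kobayashiLength Ω γ}

/-! A positive pluriharmonic function on `Ω` satisfies Harnack's inequality in the Kobayashi metric:
its logarithm is Lipschitz along curves. For `1 - Re (e z)` with `|e| = 1` this shows that a curve
of length less than `C` starting on the axis `z = 0` stays in `|z| ≤ 1 - exp (-2 C)`, so after some
number `m` of iterations, depending only on `C`, it is as close to that axis as we please. There,
while the `m`-th image of the curve is outside a fixed small polydisc around the origin, holomorphic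
discs centred on the curve stay, on a concentric disc of radius independent of `m`, where no later
iterate has a vanishing second coordinate. On such discs `Λ = log (|a| + 2) - log |w_{j + m}|` is
positive and harmonic, and Harnack's inequality applies to it with a constant independent of `m` and
`j`. A preimage of `(ε, 0)` has to be in the small polydisc at time `m`, and to get there the curve
must first let `Λ` grow to `log (|a| + 2) + 2 ^ j log 2`, whereas `Λ` is a tiny multiple of `2 ^ j`
at `(0, w)` if `|w|` is close to `1` and `j` is large. -/

open Metric InnerProductSpace

theorem norm_deriv_le_of_re_pos {ψ : ℂ → ℂ} {c : ℂ} {R : ℝ} (hR : 0 < R)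
    (hψ : DifferentiableOn ℂ ψ (ball c R)) (hre : ∀ ζ ∈ ball c R, 0 < (ψ ζ).re) :
    ‖deriv ψ c‖ ≤ 2 * (ψ c).re / R := by
  have hc : c ∈ ball c R := mem_ball_self hR
  have hb : 0 < (ψ c).re := hre c hc
  have hden : ∀ ζ ∈ ball c R, ψ ζ + (starRingEnd ℂ) (ψ c) ≠ 0 := fun ζ hζ h => by
    have := congrArg Complex.re h
    simp only [Complex.add_re, Complex.conj_re, Complex.zero_re] at this
    linarith [hre ζ hζ]
  -- the Cayley transform maps the right half-plane to the unit disc and `ψ c` to its centre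
  set φ : ℂ → ℂ := fun ζ => (ψ ζ - ψ c) / (ψ ζ + (starRingEnd ℂ) (ψ c)) with hφ
  have hφd : DifferentiableOn ℂ φ (ball c R) := (hψ.sub_const _).div (hψ.add_const _) hden
  have hφ_maps : MapsTo φ (ball c R) (closedBall (φ c) 1) := fun ζ hζ => by
    rw [show φ c = 0 by simp [hφ], mem_closedBall_zero_iff, norm_div]
    refine div_le_one_of_le₀ ((sq_le_sq₀ (norm_nonneg _) (norm_nonneg _)).1 ?_) (norm_nonneg _)
    simp only [Complex.sq_norm, Complex.normSq_apply, Complex.sub_re, Complex.sub_im,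
      Complex.add_re, Complex.add_im, Complex.conj_re, Complex.conj_im]
    nlinarith [mul_pos hb (hre ζ hζ)]
  have hψ' : HasDerivAt ψ (deriv ψ c) c :=
    (hψ.differentiableAt (ball_mem_nhds c hR)).hasDerivAt
  have hφ' : HasDerivAt φ (deriv ψ c / ((2 * (ψ c).re : ℝ) : ℂ)) c := by
    refine ((hψ'.sub_const (ψ c)).div (hψ'.add_const _) (hden c hc)).congr_deriv ?_
    have := hden c hc
    rw [← Complex.add_conj]
    field_simp
    ring
  have schwarz := Complex.norm_deriv_le_div_of_mapsTo_ball hφd hφ_maps hR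
  rw [hφ'.deriv, norm_div, Complex.norm_real, Real.norm_of_nonneg (by positivity),
    div_le_iff₀ (by positivity)] at schwarz
  exact schwarz.trans_eq (by ring)

theorem norm_fderiv_le_of_harmonicOnNhd_of_pos {h : ℂ → ℝ} {c : ℂ} {R : ℝ} (hR : 0 < R)
    (hh : HarmonicOnNhd h (ball c R)) (hpos : ∀ ζ ∈ ball c R, 0 < h ζ) :
    ‖fderiv ℝ h c‖ ≤ 2 * h c / R := by
  obtain ⟨ψ, hψ, hre⟩ := hh.exists_analyticOnNhd_ball_re_eq
  have hc : c ∈ ball c R := mem_ball_self hR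
  have hψ' : HasFDerivAt (fun ζ => (ψ ζ).re)
      (Complex.reCLM ∘L (fderiv ℂ ψ c).restrictScalars ℝ) c :=
    Complex.reCLM.hasFDerivAt.comp c ((hψ c hc).differentiableAt.hasFDerivAt.restrictScalars ℝ)
  have hfderiv : fderiv ℝ h c = Complex.reCLM ∘L (fderiv ℂ ψ c).restrictScalars ℝ :=
    (hψ'.congr_of_eventuallyEq
      (hre.symm.eventuallyEq_of_mem (ball_mem_nhds c hR))).fderiv
  calc ‖fderiv ℝ h c‖ ≤ ‖Complex.reCLM‖ * ‖(fderiv ℂ ψ c).restrictScalars ℝ‖ :=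
        hfderiv ▸ ContinuousLinearMap.opNorm_comp_le _ _
    _ = ‖deriv ψ c‖ := by
        rw [Complex.reCLM_norm, one_mul, ContinuousLinearMap.norm_restrictScalars,
          norm_deriv_eq_norm_fderiv]
    _ ≤ 2 * (ψ c).re / R :=
        norm_deriv_le_of_re_pos hR hψ.differentiableOn fun ζ hζ =>
          (hpos ζ hζ).trans_eq (hre hζ).symm
    _ = 2 * h c / R := by rw [← hre hc]

theorem norm_fderiv_mul_log_le_one {h : ℂ → ℝ} {c : ℂ} {R : ℝ} (hR : 0 < R)
    (hh : HarmonicOnNhd h (ball c R)) (hpos : ∀ ζ ∈ ball c R, 0 < h ζ) :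
    ‖fderiv ℝ (fun ζ => R / 2 * Real.log (h ζ)) c‖ ≤ 1 := by
  have hc : c ∈ ball c R := mem_ball_self hR
  have hhc : 0 < h c := hpos c hc
  have hd : DifferentiableAt ℝ h c := (hh c hc).1.differentiableAt two_ne_zero
  have hlog : HasFDerivAt (fun ζ => R / 2 * Real.log (h ζ))
      ((R / 2) • (h c)⁻¹ • fderiv ℝ h c) c :=
    (hd.hasFDerivAt.log hhc.ne').const_mul (R / 2)
  rw [hlog.fderiv, norm_smul, norm_smul, Real.norm_of_nonneg (by positivity),
    Real.norm_of_nonneg (by positivity)]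
  calc R / 2 * ((h c)⁻¹ * ‖fderiv ℝ h c‖) ≤ R / 2 * ((h c)⁻¹ * (2 * h c / R)) := by
        gcongr
        exact norm_fderiv_le_of_harmonicOnNhd_of_pos hR hh hpos
    _ = 1 := by field_simp

theorem enorm_sub_le_lintegral_of_piecewise_contDiffOn {E : Type*} [NormedAddCommGroup E]
    [NormedSpace ℝ E] {θ : ℝ → E} {s : ℕ → ℝ} (hs : Monotone s) {g : ℝ → ℝ≥0∞} {n : ℕ}
    (hθ : ∀ i < n, ContDiffOn ℝ 1 θ (Icc (s i) (s (i + 1))))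
    (hg : ∀ i < n, ∀ t ∈ Ioo (s i) (s (i + 1)), ‖deriv θ t‖ₑ ≤ g t) :
    ‖θ (s n) - θ (s 0)‖ₑ ≤ ∫⁻ t in Ioc (s 0) (s n), g t := by
  induction n with
  | zero => simp
  | succ n ih =>
    have hle : s n ≤ s (n + 1) := hs n.le_succ
    have hlast : ‖θ (s (n + 1)) - θ (s n)‖ₑ ≤ ∫⁻ t in Ioc (s n) (s (n + 1)), g t := by
      refine (enorm_sub_le_lintegral_deriv_of_contDiffOn_Icc (hθ n n.lt_succ_self) hle).trans ?_
      rw [← restrict_Ioo_eq_restrict_Icc, ← restrict_Ioo_eq_restrict_Ioc]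
      exact setLIntegral_mono' measurableSet_Ioo (hg n n.lt_succ_self)
    calc ‖θ (s (n + 1)) - θ (s 0)‖ₑ
        = ‖(θ (s n) - θ (s 0)) + (θ (s (n + 1)) - θ (s n))‖ₑ := by congr 1; abel
      _ ≤ ‖θ (s n) - θ (s 0)‖ₑ + ‖θ (s (n + 1)) - θ (s n)‖ₑ := enorm_add_le _ _
      _ ≤ (∫⁻ t in Ioc (s 0) (s n), g t) + ∫⁻ t in Ioc (s n) (s (n + 1)), g t :=
          add_le_add (ih (fun i hi => hθ i (hi.trans n.lt_succ_self))
            fun i hi => hg i (hi.trans n.lt_succ_self)) hlast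
      _ = ∫⁻ t in Ioc (s 0) (s (n + 1)), g t := by
          rw [← Ioc_union_Ioc_eq_Ioc (hs n.zero_le) hle,
            lintegral_union measurableSet_Ioc (Ioc_disjoint_Ioc_of_le le_rfl)]

theorem exists_first_hitting_time {u : ℝ → ℝ} {a b c : ℝ} (hab : a ≤ b)
    (hu : ContinuousOn u (Icc a b)) (ha : c ≤ u a) (hb : u b ≤ c) :
    ∃ τ ∈ Icc a b, u τ = c ∧ ∀ t ∈ Icc a τ, c ≤ u t := by
  have hcompact : IsCompact (Icc a b ∩ u ⁻¹' {c}) :=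
    isCompact_Icc.of_isClosed_subset
      (hu.preimage_isClosed_of_isClosed isClosed_Icc isClosed_singleton) inter_subset_left
  obtain ⟨t₁, ht₁, hut₁⟩ := intermediate_value_Icc' hab hu ⟨hb, ha⟩
  obtain ⟨τ, ⟨hτ, hτc⟩, hmin⟩ := hcompact.exists_isLeast ⟨t₁, ht₁, hut₁⟩
  refine ⟨τ, hτ, hτc, fun t ht => ?_⟩
  by_contra! hlt
  obtain ⟨t', ht', hut'⟩ := intermediate_value_Icc' ht.1
    (hu.mono (Icc_subset_Icc_right (ht.2.trans hτ.2))) ⟨hlt.le, ha⟩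
  have hτt' : τ ≤ t' := hmin ⟨⟨ht'.1, ht'.2.trans (ht.2.trans hτ.2)⟩, hut'⟩
  have htτ : t = τ := le_antisymm ht.2 (hτt'.trans ht'.2)
  exact hlt.ne (htτ ▸ hτc)

/-- `f` is a holomorphic disc in `Ω` centred at `x`: a competitor in the definition of the
Kobayashi metric of `Ω` at `x`. Only the values of `f` on the unit disc matter. -/
structure IsHolomorphicDisc (Ω : Set (ℂ × ℂ)) (x : ℂ × ℂ) (f : ℂ → ℂ × ℂ) : Prop where
  differentiableOn : DifferentiableOn ℂ f (ball 0 1)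
  mapsTo : MapsTo f (ball 0 1) Ω
  map_zero : f 0 = x

namespace IsHolomorphicDisc

variable {Ω : Set (ℂ × ℂ)} {x : ℂ × ℂ} {f : ℂ → ℂ × ℂ}

theorem const (hx : x ∈ Ω) : IsHolomorphicDisc Ω x fun _ => x :=
  ⟨differentiableOn_const x, fun _ _ => hx, rfl⟩

theorem analyticAt (hf : IsHolomorphicDisc Ω x f) {ζ : ℂ} (hζ : ζ ∈ ball (0 : ℂ) 1) :
    AnalyticAt ℂ f ζ :=
  hf.differentiableOn.analyticAt (isOpen_ball.mem_nhds hζ)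

theorem comp (hf : IsHolomorphicDisc Ω x f) {G : ℂ × ℂ → ℂ × ℂ} (hG : Differentiable ℂ G)
    (hGΩ : MapsTo G Ω Ω) : IsHolomorphicDisc Ω (G x) (G ∘ f) :=
  ⟨hG.comp_differentiableOn hf.differentiableOn, hGΩ.comp hf.mapsTo,
    congrArg G hf.map_zero⟩

end IsHolomorphicDisc

section KobayashiLength

variable {Ω : Set (ℂ × ℂ)} {E : Type*} [NormedAddCommGroup E] [NormedSpace ℝ E]

theorem enorm_le_kobayashiMetric {x : ℂ × ℂ} {L : ℂ × ℂ →L[ℝ] E}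
    (hL : ∀ f, IsHolomorphicDisc Ω x f → ‖L (deriv f 0)‖ ≤ 1) (ξ : ℂ × ℂ) :
    ‖L ξ‖ₑ ≤ kobayashiMetric Ω x ξ := by
  refine le_sInf ?_
  rintro _ ⟨r, f, hr, rfl, hfd, hfΩ, hf0, rfl⟩
  rw [← ofReal_norm, Complex.coe_smul, map_smul, norm_smul, Real.norm_of_nonneg hr.le]
  exact ENNReal.ofReal_le_ofReal (mul_le_of_le_one_right hr.le (hL f ⟨hfd, hfΩ, hf0⟩))

theorem enorm_sub_le_kobayashiLength {γ : ℝ → ℂ × ℂ} (hγ : PiecewiseSmooth γ) {τ : ℝ}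
    (hτ : τ ∈ Icc (0 : ℝ) 1) {u : ℂ × ℂ → E}
    (hu : ∀ t ∈ Icc 0 τ, ContDiffAt ℝ 1 u (γ t))
    (hdisc : ∀ t ∈ Icc 0 τ, ∀ f, IsHolomorphicDisc Ω (γ t) f →
      ‖fderiv ℝ u (γ t) (deriv f 0)‖ ≤ 1) :
    ‖u (γ τ) - u (γ 0)‖ₑ ≤ kobayashiLength Ω γ := by
  obtain ⟨-, n, t, ht, ht0, htn, hγt⟩ := hγ
  set s : ℕ → ℝ := fun i => min (t i) τ with hs
  have hs_mono : Monotone s := fun i j hij => min_le_min_right τ (ht hij)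
  have hs0 : s 0 = 0 := by simp [hs, ht0, hτ.1]
  have hsn : s n = τ := by simp [hs, htn, hτ.2]
  have hpiece : ∀ i < n, Icc (s i) (s (i + 1)) ⊆ Icc 0 τ := fun i _ =>
    Icc_subset_Icc (hs0 ▸ hs_mono i.zero_le) (min_le_right _ _)
  have hγs : ∀ i < n, ContDiffOn ℝ 1 γ (Icc (s i) (s (i + 1))) := fun i hi => by
    rcases le_total τ (t i) with hτi | hτi
    · have hsingleton : Icc (s i) (s (i + 1)) = {τ} := by
        simp [hs, hτi, hτi.trans (ht i.le_succ)]
      rw [hsingleton]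
      exact fun x hx => mem_singleton_iff.1 hx ▸ contDiffWithinAt_singleton
    · exact ((hγt i hi).of_le (by exact_mod_cast le_top)).mono
        (Icc_subset_Icc (le_min le_rfl hτi) (min_le_left _ _))
  have hspeed : ∀ i < n, ∀ r ∈ Ioo (s i) (s (i + 1)),
      ‖deriv (u ∘ γ) r‖ₑ ≤ kobayashiMetric Ω (γ r) (deriv γ r) := fun i hi r hr => by
    have hr' := hpiece i hi (Ioo_subset_Icc_self hr)
    have hγr : DifferentiableAt ℝ γ r :=
      ((hγs i hi).contDiffAt (Icc_mem_nhds hr.1 hr.2)).differentiableAt one_ne_zero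
    rw [fderiv_comp_deriv r ((hu r hr').differentiableAt one_ne_zero) hγr]
    exact enorm_le_kobayashiMetric (hdisc r hr') _
  calc ‖u (γ τ) - u (γ 0)‖ₑ
      = ‖(u ∘ γ) (s n) - (u ∘ γ) (s 0)‖ₑ := by rw [hsn, hs0]; rfl
    _ ≤ ∫⁻ r in Ioc (s 0) (s n), kobayashiMetric Ω (γ r) (deriv γ r) :=
        enorm_sub_le_lintegral_of_piecewise_contDiffOn hs_mono
          (fun i hi r hr => (hu r (hpiece i hi hr)).comp_contDiffWithinAt r (hγs i hi r hr)) hspeed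
    _ ≤ kobayashiLength Ω γ := by
        rw [hs0, hsn]
        exact lintegral_mono_set (Ioc_subset_Icc_self.trans (Icc_subset_Icc_right hτ.2))

theorem ofReal_abs_log_sub_log_le_kobayashiLength {γ : ℝ → ℂ × ℂ} (hγ : PiecewiseSmooth γ)
    {τ : ℝ} (hτ : τ ∈ Icc (0 : ℝ) 1) (hγΩ : MapsTo γ (Icc 0 τ) Ω) {v : ℂ × ℂ → ℝ}
    (hv : ∀ t ∈ Icc 0 τ, ContDiffAt ℝ 1 v (γ t)) {r : ℝ} (hr : 0 < r)
    (hdisc : ∀ t ∈ Icc 0 τ, ∀ f, IsHolomorphicDisc Ω (γ t) f →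
      HarmonicOnNhd (v ∘ f) (ball 0 r) ∧ ∀ ζ ∈ ball (0 : ℂ) r, 0 < v (f ζ)) :
    ENNReal.ofReal (r / 2 * |Real.log (v (γ τ)) - Real.log (v (γ 0))|) ≤
      kobayashiLength Ω γ := by
  have hpos : ∀ t ∈ Icc 0 τ, 0 < v (γ t) := fun t ht =>
    (hdisc t ht _ (.const (hγΩ ht))).2 0 (mem_ball_self hr)
  have hlog : ∀ t ∈ Icc 0 τ, ContDiffAt ℝ 1 (fun x => r / 2 * Real.log (v x)) (γ t) :=
    fun t ht => contDiffAt_const.mul ((hv t ht).log (hpos t ht).ne')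
  have hlip := enorm_sub_le_kobayashiLength (Ω := Ω) hγ hτ hlog fun t ht f hf => by
    have hchain : fderiv ℝ (fun x => r / 2 * Real.log (v x)) (γ t) (deriv f 0) =
        fderiv ℝ (fun ζ => r / 2 * Real.log (v (f ζ))) 0 1 := by
      have hfd := (hf.analyticAt (mem_ball_self one_pos)).differentiableAt.hasDerivAt
      have hd := (hlog t ht).differentiableAt one_ne_zero |>.hasFDerivAt
      rw [← hf.map_zero] at hd ⊢
      have := (hd.comp (0 : ℂ) (hfd.hasFDerivAt.restrictScalars ℝ)).fderiv
      simp only [Function.comp_def] at this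
      simp [this]
    obtain ⟨hharm, hpos_disc⟩ := hdisc t ht f hf
    rw [hchain]
    exact (ContinuousLinearMap.le_of_opNorm_le _
      (norm_fderiv_mul_log_le_one hr hharm hpos_disc) 1).trans (by simp)
  rwa [← mul_sub, ← ofReal_norm, norm_mul, Real.norm_of_nonneg (by positivity),
    Real.norm_eq_abs] at hlip

end KobayashiLength

theorem le_kobayashiDist {Ω : Set (ℂ × ℂ)} {x y : ℂ × ℂ} {C : ℝ≥0∞}
    (h : ∀ γ, PiecewiseSmooth γ → MapsTo γ (Icc 0 1) Ω → γ 0 = x → γ 1 = y →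
      C ≤ kobayashiLength Ω γ) :
    C ≤ kobayashiDist Ω x y := by
  refine le_sInf ?_
  rintro _ ⟨γ, hγ, hγΩ, h0, h1, rfl⟩
  exact h γ hγ hγΩ h0 h1

theorem norm_fst_le_of_kobayashiLength_lt {Ω : Set (ℂ × ℂ)} (hΩ : ∀ x ∈ Ω, ‖x.1‖ < 1)
    {γ : ℝ → ℂ × ℂ} (hγ : PiecewiseSmooth γ) (hγΩ : MapsTo γ (Icc 0 1) Ω) (h0 : (γ 0).1 = 0)
    {C : ℝ} (hC : kobayashiLength Ω γ < ENNReal.ofReal C) {t : ℝ} (ht : t ∈ Icc (0 : ℝ) 1) :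
    ‖(γ t).1‖ ≤ 1 - Real.exp (-(2 * C)) := by
  obtain ⟨e, he, hnorm⟩ := RCLike.exists_norm_eq_mul_self (γ t).1
  set v : ℂ × ℂ → ℝ := fun x => (1 - e * x.1).re with hv
  have hv_pos : ∀ x ∈ Ω, 0 < v x := fun x hx => by
    have : (e * x.1).re ≤ ‖x.1‖ := (Complex.re_le_norm _).trans_eq (by rw [norm_mul, he, one_mul])
    simp only [hv, Complex.sub_re, Complex.one_re]
    linarith [hΩ x hx]
  have hv0 : v (γ 0) = 1 := by simp [hv, h0]
  have hvt : v (γ t) = 1 - ‖(γ t).1‖ := by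
    simp only [hv, ← hnorm]
    exact congrArg (1 - ·) (Complex.ofReal_re _)
  have harnack := ofReal_abs_log_sub_log_le_kobayashiLength hγ ht
    (hγΩ.mono_left (Icc_subset_Icc_right ht.2)) (v := v)
    (fun s _ => Complex.reCLM.contDiff.contDiffAt.comp (γ s)
      (contDiffAt_const.sub (contDiffAt_const.mul contDiffAt_fst))) one_pos fun s _ f hf =>
    ⟨fun ζ hζ => (analyticAt_const.sub (analyticAt_const.mul
      (analyticAt_fst.comp (hf.analyticAt hζ)))).harmonicAt_re,
      fun ζ hζ => hv_pos _ (hf.mapsTo hζ)⟩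
  have hlog : |Real.log (1 - ‖(γ t).1‖)| < 2 * C := by
    rw [hv0, Real.log_one, sub_zero, hvt] at harnack
    linarith [(ENNReal.ofReal_lt_ofReal_iff_of_nonneg (by positivity)).1 (harnack.trans_lt hC)]
  have hpos : 0 < 1 - ‖(γ t).1‖ := sub_pos.2 (hΩ _ (hγΩ ht))
  linarith [(Real.lt_log_iff_exp_lt hpos).1 (abs_lt.1 hlog).1]

section Orbits

variable {a : ℂ} {x : ℂ × ℂ}

/-- The full basin of attraction of the origin under the skew product. -/
abbrev skewBasin (a : ℂ) : Set (ℂ × ℂ) :=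
  attractingBasin (skewMap a) (0, 0)

theorem skewMap_iterate_contDiff (a : ℂ) {n : WithTop ℕ∞} (k : ℕ) :
    ContDiff ℂ n (skewMap a)^[k] := by
  induction k with
  | zero => exact contDiff_id
  | succ k ih => exact ih.comp (by unfold skewMap; fun_prop)

theorem skewMap_iterate_fst (a : ℂ) (n : ℕ) (x : ℂ × ℂ) :
    ((skewMap a)^[n] x).1 = x.1 ^ 2 ^ n := by
  induction n with
  | zero => simp
  | succ n ih => rw [Function.iterate_succ_apply', skewMap, ih, pow_succ 2 n, pow_mul]

theorem skewMap_iterate_zero_mk (a w : ℂ) (n : ℕ) :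
    (skewMap a)^[n] (0, w) = (0, w ^ 2 ^ n) := by
  induction n with
  | zero => simp
  | succ n ih => rw [Function.iterate_succ_apply', ih, skewMap]; simp [pow_succ, pow_mul]

theorem iterate_mem_attractingBasin {F : ℂ × ℂ → ℂ × ℂ} {x₀ : ℂ × ℂ} (k : ℕ) :
    F^[k] x ∈ attractingBasin F x₀ ↔ x ∈ attractingBasin F x₀ := by
  simp only [attractingBasin, mem_ofPred_eq, ← Function.iterate_add_apply]
  exact tendsto_add_atTop_iff_nat (f := fun n => F^[n] x) k

theorem mem_skewBasin_iff_tendsto_norm :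
    x ∈ skewBasin a ↔ Tendsto (fun n : ℕ => ‖(skewMap a)^[n] x‖) atTop (𝓝 0) :=
  tendsto_zero_iff_norm_tendsto_zero

theorem mem_skewBasin_of_norm_iterate_le {g : ℕ → ℝ} (hg : Tendsto g atTop (𝓝 0))
    (h : ∀ n, ‖(skewMap a)^[n] x‖ ≤ g n) : x ∈ skewBasin a :=
  mem_skewBasin_iff_tendsto_norm.2 (squeeze_zero (fun _ => norm_nonneg _) h hg)

theorem exists_norm_iterate_lt (hx : x ∈ skewBasin a) {δ : ℝ} (hδ : 0 < δ) :
    ∃ n, ‖(skewMap a)^[n] x‖ < δ :=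
  ((mem_skewBasin_iff_tendsto_norm.1 hx).eventually_lt_const hδ).exists

theorem norm_fst_lt_one_of_mem_skewBasin (hx : x ∈ skewBasin a) : ‖x.1‖ < 1 := by
  by_contra! h
  obtain ⟨n, hn⟩ := exists_norm_iterate_lt hx one_pos
  have hfst := (norm_fst_le _).trans_lt hn
  rw [skewMap_iterate_fst, norm_pow] at hfst
  exact (one_le_pow₀ h).not_gt hfst

theorem norm_snd_lt_of_mem_skewBasin (hx : x ∈ skewBasin a) : ‖x.2‖ < ‖a‖ + 2 := by
  by_contra! h
  have hge : ∀ n : ℕ, ‖a‖ + 2 ≤ ‖((skewMap a)^[n] x).2‖ := fun n => by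
    induction n with
    | zero => exact h
    | succ n ih =>
      have hz := norm_fst_lt_one_of_mem_skewBasin ((iterate_mem_attractingBasin n).2 hx)
      rw [Function.iterate_succ_apply']
      set y := (skewMap a)^[n] x
      have hsub : ‖y.2‖ ^ 2 - ‖a‖ * ‖y.1‖ ≤ ‖y.2 ^ 2 + a * y.1‖ := by
        rw [← norm_pow, ← norm_mul]
        exact norm_sub_le_norm_add _ _
      refine le_trans ?_ hsub
      nlinarith [norm_nonneg a]
  obtain ⟨n, hn⟩ := exists_norm_iterate_lt hx (show 0 < ‖a‖ + 2 by positivity)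
  exact ((hge n).trans (norm_snd_le _)).not_gt hn

theorem tendsto_pow_two_pow {r : ℝ} (h0 : 0 ≤ r) (h1 : r < 1) :
    Tendsto (fun n : ℕ => r ^ 2 ^ n) atTop (𝓝 0) :=
  (tendsto_pow_atTop_nhds_zero_of_lt_one h0 h1).comp
    (tendsto_pow_atTop_atTop_of_one_lt one_lt_two)

theorem zero_mk_mem_skewBasin (a : ℂ) {w : ℂ} (hw : ‖w‖ < 1) : (0, w) ∈ skewBasin a :=
  mem_skewBasin_of_norm_iterate_le (tendsto_pow_two_pow (norm_nonneg w) hw) fun n => by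
    simp [skewMap_iterate_zero_mk, Prod.norm_def]

end Orbits

/-- The weighted scaling of `ℂ²` for which the skew product is homogeneous of degree two. -/
def parabolicScaling (l : ℂ) (x : ℂ × ℂ) : ℂ × ℂ :=
  (l ^ 2 * x.1, l * x.2)

theorem skewMap_iterate_parabolicScaling (a l : ℂ) (x : ℂ × ℂ) (n : ℕ) :
    (skewMap a)^[n] (parabolicScaling l x) =
      parabolicScaling (l ^ 2 ^ n) ((skewMap a)^[n] x) := by
  induction n with
  | zero => simp
  | succ n ih =>
    rw [Function.iterate_succ_apply', ih, Function.iterate_succ_apply', skewMap, skewMap]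
    ext <;> simp only [parabolicScaling, pow_succ 2 n, pow_mul] <;> ring

theorem norm_parabolicScaling_le {l : ℂ} (hl : ‖l‖ ≤ 1) (x : ℂ × ℂ) :
    ‖parabolicScaling l x‖ ≤ ‖x‖ := by
  simp only [parabolicScaling, Prod.norm_def, norm_mul, norm_pow]
  exact max_le_max
    (mul_le_of_le_one_left (norm_nonneg _) (pow_le_one₀ (norm_nonneg _) hl))
    (mul_le_of_le_one_left (norm_nonneg _) hl)

theorem parabolicScaling_mem_skewBasin {a l : ℂ} (hl : ‖l‖ ≤ 1) {x : ℂ × ℂ}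
    (hx : x ∈ skewBasin a) : parabolicScaling l x ∈ skewBasin a :=
  mem_skewBasin_of_norm_iterate_le (mem_skewBasin_iff_tendsto_norm.1 hx) fun n => by
    rw [skewMap_iterate_parabolicScaling]
    refine norm_parabolicScaling_le ?_ _
    rw [norm_pow]
    exact pow_le_one₀ (norm_nonneg _) hl

theorem immediateBasin_skewMap (a : ℂ) :
    immediateBasin (skewMap a) (0, 0) = skewBasin a := by
  refine Subset.antisymm (connectedComponentIn_subset _ _) fun x hx => ?_
  set c : ℝ → ℂ × ℂ := fun l => parabolicScaling l x with hc
  have hcont : Continuous c := by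
    simp only [hc, parabolicScaling]
    fun_prop
  have hpre : IsPreconnected (c '' Icc 0 1) := isPreconnected_Icc.image c hcont.continuousOn
  refine hpre.subset_connectedComponentIn ⟨0, by simp, by simp [hc, parabolicScaling]⟩ ?_
    ⟨1, by simp, by simp [hc, parabolicScaling]⟩
  rintro _ ⟨l, hl, rfl⟩
  refine parabolicScaling_mem_skewBasin ?_ hx
  rw [Complex.norm_real, Real.norm_of_nonneg hl.1]
  exact hl.2

section Regions

variable {a : ℂ}

/-- Polydiscs around the origin, shrinking with `ρ`, that attest superattraction: the skew product
maps the one of parameter `ρ` into the one of parameter `ρ²`. -/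
def trappingPolydisc (a : ℂ) (ρ : ℝ) : Set (ℂ × ℂ) :=
  {x | ‖x.2‖ ≤ ρ / 2 ∧ 4 * (‖a‖ + 1) * ‖x.1‖ ≤ ρ ^ 2}

theorem mapsTo_skewMap_trappingPolydisc (a : ℂ) (ρ : ℝ) :
    MapsTo (skewMap a) (trappingPolydisc a ρ) (trappingPolydisc a (ρ ^ 2)) := by
  rintro x ⟨hw, hz⟩
  have ha := norm_nonneg a
  have hz0 := norm_nonneg x.1
  simp only [trappingPolydisc, skewMap, mem_ofPred_eq, norm_pow]
  constructor
  · calc ‖x.2 ^ 2 + a * x.1‖ ≤ ‖x.2‖ ^ 2 + ‖a‖ * ‖x.1‖ := by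
          rw [← norm_pow, ← norm_mul]
          exact norm_add_le _ _
      _ ≤ (ρ / 2) ^ 2 + ρ ^ 2 / 4 := by
          gcongr
          nlinarith
      _ = ρ ^ 2 / 2 := by ring
  · calc 4 * (‖a‖ + 1) * ‖x.1‖ ^ 2 ≤ (4 * (‖a‖ + 1) * ‖x.1‖) ^ 2 := by
          rw [mul_pow]
          gcongr
          exact le_self_pow₀ (by linarith) two_ne_zero
      _ ≤ (ρ ^ 2) ^ 2 := by gcongr

theorem mapsTo_iterate_trappingPolydisc (a : ℂ) (ρ : ℝ) (n : ℕ) :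
    MapsTo (skewMap a)^[n] (trappingPolydisc a ρ) (trappingPolydisc a (ρ ^ 2 ^ n)) := by
  induction n with
  | zero => simpa using mapsTo_id _
  | succ n ih =>
    rw [Function.iterate_succ', pow_succ 2 n, pow_mul]
    exact (mapsTo_skewMap_trappingPolydisc a _).comp ih

theorem trappingPolydisc_mono (a : ℂ) {ρ σ : ℝ} (hρ : 0 ≤ ρ) (h : ρ ≤ σ) :
    trappingPolydisc a ρ ⊆ trappingPolydisc a σ := fun _ hx =>
  ⟨hx.1.trans (by gcongr), hx.2.trans (by gcongr)⟩

theorem norm_le_of_mem_trappingPolydisc {ρ : ℝ} (hρ : 0 ≤ ρ) (hρ1 : ρ ≤ 1) {x : ℂ × ℂ}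
    (hx : x ∈ trappingPolydisc a ρ) : ‖x‖ ≤ ρ := by
  have hz := norm_nonneg x.1
  exact max_le (by nlinarith [hx.2, norm_nonneg a]) (by linarith [hx.1])

theorem trappingPolydisc_subset_skewBasin (a : ℂ) {ρ : ℝ} (hρ : 0 ≤ ρ) (hρ1 : ρ < 1) :
    trappingPolydisc a ρ ⊆ skewBasin a := fun _ hx =>
  mem_skewBasin_of_norm_iterate_le (tendsto_pow_two_pow hρ hρ1) fun n =>
    norm_le_of_mem_trappingPolydisc (pow_nonneg hρ _) (pow_le_one₀ hρ hρ1.le)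
      (mapsTo_iterate_trappingPolydisc a ρ n hx)

/-- A forward invariant region in which `w²` dominates `z`, so that the second coordinate of the
orbit never vanishes. -/
def verticalRegion (a : ℂ) : Set (ℂ × ℂ) :=
  {x | x.2 ≠ 0 ∧ 2 * (‖a‖ + 1) * ‖x.1‖ ≤ ‖x.2‖ ^ 2}

theorem mapsTo_skewMap_verticalRegion (a : ℂ) :
    MapsTo (skewMap a) (verticalRegion a) (verticalRegion a) := by
  rintro x ⟨hw0, hz⟩
  have ha := norm_nonneg a
  have hz0 := norm_nonneg x.1
  have hw := norm_pos_iff.2 hw0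
  have hsub : ‖x.2‖ ^ 2 - ‖a‖ * ‖x.1‖ ≤ ‖x.2 ^ 2 + a * x.1‖ := by
    rw [← norm_pow, ← norm_mul]
    exact norm_sub_le_norm_add _ _
  simp only [verticalRegion, skewMap, mem_ofPred_eq, norm_pow]
  constructor
  · rw [← norm_pos_iff]
    nlinarith [pow_pos hw 2]
  · calc 2 * (‖a‖ + 1) * ‖x.1‖ ^ 2 ≤ ((‖a‖ + 2) * ‖x.1‖) ^ 2 := by
          rw [mul_pow]
          gcongr
          nlinarith
      _ ≤ ‖x.2 ^ 2 + a * x.1‖ ^ 2 := by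
          gcongr
          linarith

/-- How small `z` must be for `verticalRegion a` to contain the points of the basin outside
`trappingPolydisc a (1 / 2)` with room to spare. -/
noncomputable def axisThreshold (a : ℂ) : ℝ :=
  1 / (256 * (‖a‖ + 1))

theorem axisThreshold_pos (a : ℂ) : 0 < axisThreshold a := by
  unfold axisThreshold
  positivity

theorem axisThreshold_le (a : ℂ) : axisThreshold a ≤ 1 / 256 :=
  one_div_le_one_div_of_le (by norm_num) (by linarith [norm_nonneg a])

theorem mem_verticalRegion_of_norm_fst_le {x : ℂ × ℂ} (hz : ‖x.1‖ ≤ 2 * axisThreshold a)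
    (hw : 1 / 8 ≤ ‖x.2‖) : x ∈ verticalRegion a := by
  refine ⟨norm_pos_iff.1 (by linarith), ?_⟩
  calc 2 * (‖a‖ + 1) * ‖x.1‖ ≤ 2 * (‖a‖ + 1) * (2 * axisThreshold a) := by gcongr
    _ = (1 / 8) ^ 2 := by
        have : ‖a‖ + 1 ≠ 0 := by positivity
        unfold axisThreshold
        field_simp
        norm_num
    _ ≤ ‖x.2‖ ^ 2 := by gcongr

theorem lt_norm_snd_of_notMem_trappingPolydisc {x : ℂ × ℂ} (hx : x ∉ trappingPolydisc a (1 / 2))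
    (hz : ‖x.1‖ ≤ axisThreshold a) : 1 / 4 < ‖x.2‖ := by
  by_contra! hw
  refine hx ⟨by linarith, ?_⟩
  calc 4 * (‖a‖ + 1) * ‖x.1‖ ≤ 4 * (‖a‖ + 1) * axisThreshold a := by gcongr
    _ = 1 / 64 := by
        have : ‖a‖ + 1 ≠ 0 := by positivity
        unfold axisThreshold
        field_simp
        norm_num
    _ ≤ (1 / 2) ^ 2 := by norm_num

theorem iterate_mem_trappingPolydisc {q y : ℂ × ℂ} (hy : y ∈ trappingPolydisc a (1 / 2))
    (hyV : y ∉ verticalRegion a) {k : ℕ} (hk : (skewMap a)^[k] q = y) {m : ℕ}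
    (hz : ‖((skewMap a)^[m] q).1‖ ≤ axisThreshold a) :
    (skewMap a)^[m] q ∈ trappingPolydisc a (1 / 2) := by
  by_contra hm
  rcases le_total m k with hmk | hkm
  · obtain ⟨l, rfl⟩ := Nat.exists_eq_add_of_le' hmk
    rw [Function.iterate_add_apply] at hk
    have hqV : (skewMap a)^[m] q ∈ verticalRegion a :=
      mem_verticalRegion_of_norm_fst_le (by linarith [axisThreshold_pos a])
        (by linarith [lt_norm_snd_of_notMem_trappingPolydisc hm hz])
    exact hyV (hk ▸ (mapsTo_skewMap_verticalRegion a).iterate l hqV)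
  · obtain ⟨l, rfl⟩ := Nat.exists_eq_add_of_le' hkm
    rw [Function.iterate_add_apply, hk] at hm
    exact hm (trappingPolydisc_mono a (by positivity)
      (pow_le_of_le_one (by norm_num) (by norm_num) (by positivity))
      (mapsTo_iterate_trappingPolydisc a _ l hy))

end Regions

section HarnackAwayFromAxis

variable {a : ℂ}

/-- A radius on which the holomorphic discs in the basin stay in `verticalRegion a` when they are
centred close to the axis `z = 0` but outside `trappingPolydisc a (1 / 2)`. -/
noncomputable def axisAvoidanceRadius (a : ℂ) : ℝ :=
  axisThreshold a / (2 * (‖a‖ + 2))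

theorem axisAvoidanceRadius_pos (a : ℂ) : 0 < axisAvoidanceRadius a :=
  div_pos (axisThreshold_pos a) (by positivity)

theorem axisAvoidanceRadius_le_one (a : ℂ) : axisAvoidanceRadius a ≤ 1 :=
  div_le_one_of_le₀ (by linarith [axisThreshold_le a, norm_nonneg a]) (by positivity)

theorem norm_lt_of_mem_skewBasin {x : ℂ × ℂ} (hx : x ∈ skewBasin a) : ‖x‖ < ‖a‖ + 2 :=
  max_lt (by linarith [norm_fst_lt_one_of_mem_skewBasin hx, norm_nonneg a])
    (norm_snd_lt_of_mem_skewBasin hx)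

theorem IsHolomorphicDisc.mem_verticalRegion {x : ℂ × ℂ} {f : ℂ → ℂ × ℂ}
    (hf : IsHolomorphicDisc (skewBasin a) x f) (hx : x ∉ trappingPolydisc a (1 / 2))
    (hz : ‖x.1‖ ≤ axisThreshold a) {ζ : ℂ} (hζ : ζ ∈ ball (0 : ℂ) (axisAvoidanceRadius a)) :
    f ζ ∈ verticalRegion a := by
  have hM : 0 < 2 * (‖a‖ + 2) := by positivity
  have hmaps : MapsTo f (ball 0 1) (closedBall (f 0) (2 * (‖a‖ + 2))) := fun η hη => by
    rw [mem_closedBall, dist_eq_norm]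
    linarith [norm_sub_le (f η) (f 0), norm_lt_of_mem_skewBasin (hf.mapsTo hη),
      norm_lt_of_mem_skewBasin (hf.mapsTo (mem_ball_self one_pos))]
  have hdist : ‖f ζ - x‖ < axisThreshold a := by
    have schwarz := Complex.dist_le_div_mul_dist_of_mapsTo_ball hf.differentiableOn hmaps
      (ball_subset_ball (axisAvoidanceRadius_le_one a) hζ)
    rw [div_one, hf.map_zero, dist_eq_norm] at schwarz
    exact schwarz.trans_lt (by rwa [mul_comm, ← lt_div_iff₀ hM])
  have hfst : ‖(f ζ).1 - x.1‖ < axisThreshold a := (norm_fst_le (f ζ - x)).trans_lt hdist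
  have hsnd : ‖(f ζ).2 - x.2‖ < axisThreshold a := (norm_snd_le (f ζ - x)).trans_lt hdist
  have hw := lt_norm_snd_of_notMem_trappingPolydisc hx hz
  refine mem_verticalRegion_of_norm_fst_le ?_ ?_
  · linarith [norm_le_norm_add_norm_sub' (f ζ).1 x.1]
  · linarith [norm_le_norm_add_norm_sub' x.2 (f ζ).2, norm_sub_rev x.2 (f ζ).2,
      axisThreshold_le a]

/-- With `F^n (z, w) = (zₙ, wₙ)`, the function `log (|a| + 2) - log |wₙ|`: it is positive on the
basin and pluriharmonic where `wₙ ≠ 0`. -/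
noncomputable def logPotential (a : ℂ) (n : ℕ) (x : ℂ × ℂ) : ℝ :=
  Real.log (‖a‖ + 2) - Real.log ‖((skewMap a)^[n] x).2‖

theorem logPotential_pos {n : ℕ} {x : ℂ × ℂ} (hx : x ∈ skewBasin a)
    (h0 : ((skewMap a)^[n] x).2 ≠ 0) : 0 < logPotential a n x :=
  sub_pos.2 (Real.log_lt_log (norm_pos_iff.2 h0)
    (norm_snd_lt_of_mem_skewBasin ((iterate_mem_attractingBasin n).2 hx)))

theorem contDiffAt_logPotential {n : ℕ} {x : ℂ × ℂ} (h0 : ((skewMap a)^[n] x).2 ≠ 0) :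
    ContDiffAt ℝ 1 (logPotential a n) x :=
  contDiffAt_const.sub ((((skewMap_iterate_contDiff a n).restrict_scalars ℝ).snd.contDiffAt.norm ℝ
    h0).log (norm_ne_zero_iff.2 h0))

theorem harmonicAt_logPotential_comp {n : ℕ} {f : ℂ → ℂ × ℂ} {ζ : ℂ} (hf : AnalyticAt ℂ f ζ)
    (h0 : ((skewMap a)^[n] (f ζ)).2 ≠ 0) : HarmonicAt (logPotential a n ∘ f) ζ :=
  (harmonicAt_const _).sub ((analyticAt_snd.comp
    ((skewMap_iterate_contDiff a n).contDiffAt.analyticAt.comp hf)).harmonicAt_log_norm h0)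

theorem ofReal_abs_log_logPotential_sub_le_kobayashiLength {γ : ℝ → ℂ × ℂ}
    (hγ : PiecewiseSmooth γ) {τ : ℝ} (hτ : τ ∈ Icc (0 : ℝ) 1)
    (hγΩ : MapsTo γ (Icc 0 τ) (skewBasin a)) {m : ℕ}
    (hz : ∀ t ∈ Icc 0 τ, ‖((skewMap a)^[m] (γ t)).1‖ ≤ axisThreshold a)
    (hγP : ∀ t ∈ Icc 0 τ, (skewMap a)^[m] (γ t) ∉ trappingPolydisc a (1 / 2)) (j : ℕ) :
    ENNReal.ofReal (axisAvoidanceRadius a / 2 * |Real.log (logPotential a (j + m) (γ τ)) -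
      Real.log (logPotential a (j + m) (γ 0))|) ≤ kobayashiLength (skewBasin a) γ := by
  have hdisc_ne : ∀ t ∈ Icc 0 τ, ∀ f, IsHolomorphicDisc (skewBasin a) (γ t) f →
      ∀ ζ ∈ ball (0 : ℂ) (axisAvoidanceRadius a),
        ((skewMap a)^[j + m] (f ζ)).2 ≠ 0 := fun t ht f hf ζ hζ => by
    have hFf := hf.comp ((skewMap_iterate_contDiff a (n := 1) m).differentiable one_ne_zero)
      fun y hy => (iterate_mem_attractingBasin m).2 hy
    rw [Function.iterate_add_apply]
    exact ((mapsTo_skewMap_verticalRegion a).iterate j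
      (hFf.mem_verticalRegion (hγP t ht) (hz t ht) hζ)).1
  refine ofReal_abs_log_sub_log_le_kobayashiLength hγ hτ hγΩ (fun t ht =>
    contDiffAt_logPotential (hdisc_ne t ht _ (.const (hγΩ ht)) 0
      (mem_ball_self (axisAvoidanceRadius_pos a)))) (axisAvoidanceRadius_pos a)
    fun t ht f hf => ⟨fun ζ hζ => ?_, fun ζ hζ => ?_⟩
  all_goals have hζ1 : ζ ∈ ball (0 : ℂ) 1 := ball_subset_ball (axisAvoidanceRadius_le_one a) hζ
  · exact harmonicAt_logPotential_comp (hf.analyticAt hζ1) (hdisc_ne t ht f hf ζ hζ)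
  · exact logPotential_pos (hf.mapsTo hζ1) (hdisc_ne t ht f hf ζ hζ)

theorem ofReal_le_kobayashiLength_of_iterate_mem_trappingPolydisc {γ : ℝ → ℂ × ℂ}
    (hγ : PiecewiseSmooth γ) (hγΩ : MapsTo γ (Icc 0 1) (skewBasin a)) {m j : ℕ}
    (hz : ∀ t ∈ Icc (0 : ℝ) 1, ‖((skewMap a)^[m] (γ t)).1‖ ≤ axisThreshold a)
    (hend : (skewMap a)^[m] (γ 1) ∈ trappingPolydisc a (1 / 2))
    (hstart : (1 / 2) ^ 2 ^ j ≤ ‖((skewMap a)^[j + m] (γ 0)).2‖) {C : ℝ}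
    (hC : Real.exp (2 * C / axisAvoidanceRadius a) * logPotential a (j + m) (γ 0) ≤
      Real.log (‖a‖ + 2) + 2 ^ j * Real.log 2) :
    ENNReal.ofReal C ≤ kobayashiLength (skewBasin a) γ := by
  set c : ℝ := (1 / 2) ^ 2 ^ j with hc
  have hc0 : 0 < c := by positivity
  have hr := axisAvoidanceRadius_pos a
  have hsmall : ∀ t, (skewMap a)^[m] (γ t) ∈ trappingPolydisc a (1 / 2) →
      ‖((skewMap a)^[j + m] (γ t)).2‖ < c := fun t ht => by
    rw [Function.iterate_add_apply]
    linarith [(mapsTo_iterate_trappingPolydisc a _ j ht).1]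
  have hcont : ContinuousOn (fun t => ‖((skewMap a)^[j + m] (γ t)).2‖) (Icc 0 1) :=
    ((skewMap_iterate_contDiff a (n := 0) _).continuous.comp_continuousOn hγ.1).snd.norm
  obtain ⟨τ, hτ, hτc, hge⟩ :=
    exists_first_hitting_time zero_le_one hcont hstart (hsmall 1 hend).le
  have hτ1 : Icc 0 τ ⊆ Icc 0 1 := Icc_subset_Icc_right hτ.2
  have harnack := ofReal_abs_log_logPotential_sub_le_kobayashiLength hγ hτ (hγΩ.mono_left hτ1)
    (fun t ht => hz t (hτ1 ht)) (fun t ht hP => (hsmall t hP).not_ge (hge t ht)) j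
  have hΛτ : logPotential a (j + m) (γ τ) = Real.log (‖a‖ + 2) + 2 ^ j * Real.log 2 := by
    rw [logPotential, hτc, hc, Real.log_pow, one_div, Real.log_inv]
    push_cast
    ring
  have hΛ0 : 0 < logPotential a (j + m) (γ 0) :=
    logPotential_pos (hγΩ (left_mem_Icc.2 zero_le_one))
      (norm_pos_iff.1 (hc0.trans_le hstart))
  have hlog : 2 * C / axisAvoidanceRadius a ≤ Real.log (logPotential a (j + m) (γ τ)) -
      Real.log (logPotential a (j + m) (γ 0)) := by
    rw [hΛτ, le_sub_iff_add_le, ← Real.log_exp (2 * C / _),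
      ← Real.log_mul (Real.exp_ne_zero _) hΛ0.ne']
    exact Real.log_le_log (by positivity) hC
  refine (ENNReal.ofReal_le_ofReal ?_).trans harnack
  calc C = axisAvoidanceRadius a / 2 * (2 * C / axisAvoidanceRadius a) := by field_simp
    _ ≤ _ := by
      gcongr
      exact hlog.trans (le_abs_self _)

end HarnackAwayFromAxis

theorem exists_basePoint (a : ℂ) (m : ℕ) {E : ℝ} (hE : 1 ≤ E) :
    ∃ w : ℂ, ‖w‖ < 1 ∧ ∃ j : ℕ, (1 / 2) ^ 2 ^ j ≤ ‖((skewMap a)^[j + m] (0, w)).2‖ ∧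
      E * logPotential a (j + m) (0, w) ≤ Real.log (‖a‖ + 2) + 2 ^ j * Real.log 2 := by
  have hlog2 : 0 < Real.log 2 := Real.log_pos one_lt_two
  -- chosen so that `F^[j + m] (0, exp (-s))` has second coordinate `exp (-2 ^ j * log 2 / (2 * E))`
  set s : ℝ := Real.log 2 / (2 ^ m * (2 * E)) with hs
  have hs0 : 0 < s := by positivity
  have hw : ‖Complex.exp (-s : ℝ)‖ = Real.exp (-s) := by rw [Complex.norm_exp, Complex.ofReal_re]
  obtain ⟨j, hj⟩ := (((tendsto_pow_atTop_atTop_of_one_lt (one_lt_two (α := ℝ))).atTop_mul_const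
    (half_pos hlog2)).eventually_ge_atTop ((E - 1) * Real.log (‖a‖ + 2))).exists
  have horbit : ‖((skewMap a)^[j + m] (0, Complex.exp (-s : ℝ))).2‖ =
      Real.exp (-(2 ^ j * Real.log 2 / (2 * E))) := by
    rw [skewMap_iterate_zero_mk, norm_pow, hw, ← Real.exp_nat_mul, hs]
    congr 1
    push_cast
    field_simp
    ring
  refine ⟨Complex.exp (-s : ℝ), by rwa [hw, Real.exp_lt_one_iff, neg_lt_zero], j, ?_, ?_⟩
  · calc ((1 : ℝ) / 2) ^ 2 ^ j = Real.exp (-(2 ^ j * Real.log 2)) := by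
          rw [← Real.exp_log (show (0 : ℝ) < (1 / 2) ^ 2 ^ j by positivity), Real.log_pow, one_div,
            Real.log_inv]
          push_cast
          rw [mul_neg]
      _ ≤ _ := by
          rw [horbit]
          gcongr
          exact div_le_self (by positivity) (by linarith)
  · calc E * logPotential a (j + m) (0, Complex.exp (-s : ℝ))
        = E * Real.log (‖a‖ + 2) + 2 ^ j * (Real.log 2 / 2) := by
          rw [logPotential, horbit, Real.log_exp]
          field_simp
          ring
      _ ≤ Real.log (‖a‖ + 2) + 2 ^ j * Real.log 2 := by linarith

theorem theorem4p1_general (a : ℂ) (C : NNReal) :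
    ∃ p ∈ immediateBasin (skewMap a) (0, 0),
      ∀ y ∈ trappingPolydisc a (1 / 2) \ verticalRegion a,
        ∀ q ∈ ⋃ k : ℕ, (skewMap a)^[k] ⁻¹' {y},
          q ∈ immediateBasin (skewMap a) (0, 0) ∧
            (C : ℝ≥0∞) ≤ kobayashiDist (immediateBasin (skewMap a) (0, 0)) p q := by
  rw [immediateBasin_skewMap]
  set ρ : ℝ := 1 - Real.exp (-(2 * C))
  have hρ0 : 0 ≤ ρ := sub_nonneg.2 (Real.exp_le_one_iff.2 (by simp))
  have hρ1 : ρ < 1 := sub_lt_self _ (Real.exp_pos _)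
  obtain ⟨m, hm⟩ :=
    ((tendsto_pow_two_pow hρ0 hρ1).eventually_le_const (axisThreshold_pos a)).exists
  obtain ⟨w, hw, j, hstart, hC⟩ := exists_basePoint a m (Real.one_le_exp
    (div_nonneg (by positivity : (0 : ℝ) ≤ 2 * C) (axisAvoidanceRadius_pos a).le))
  refine ⟨(0, w), zero_mk_mem_skewBasin a hw, ?_⟩
  rintro y ⟨hyP, hyV⟩ q hq
  obtain ⟨k, hk⟩ := mem_iUnion.1 hq
  have hyΩ := trappingPolydisc_subset_skewBasin a (by norm_num) (by norm_num) hyP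
  refine ⟨(iterate_mem_attractingBasin k).1 (mem_singleton_iff.1 hk ▸ hyΩ),
    le_kobayashiDist fun γ hγ hγΩ h0 h1 => ?_⟩
  by_contra! hlt
  rw [← ENNReal.ofReal_coe_nnreal] at hlt
  have hz : ∀ t ∈ Icc (0 : ℝ) 1, ‖((skewMap a)^[m] (γ t)).1‖ ≤ axisThreshold a := fun t ht => by
    rw [skewMap_iterate_fst, norm_pow]
    refine le_trans (pow_le_pow_left₀ (norm_nonneg _) ?_ _) hm
    exact norm_fst_le_of_kobayashiLength_lt (fun x => norm_fst_lt_one_of_mem_skewBasin) hγ hγΩ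
      (by rw [h0]) hlt ht
  have hend := iterate_mem_trappingPolydisc hyP hyV hk (h1 ▸ hz 1 (right_mem_Icc.2 zero_le_one))
  exact hlt.not_ge (ofReal_le_kobayashiLength_of_iterate_mem_trappingPolydisc hγ hγΩ hz
    (h1 ▸ hend) (h0 ▸ hstart) (h0 ▸ hC))

theorem theorem4p1 (a : ℂ) (ha : a ≠ 0) :
    ∃ ε₀ : ℝ, 0 < ε₀ ∧ ∀ ε : ℝ, 0 < ε → ε < ε₀ → ∀ C : ℝ, 0 < C →
      ∃ p ∈ immediateBasin (skewMap a) (0, 0),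
        ∀ q ∈ ⋃ k : ℕ, (skewMap a)^[k] ⁻¹' {((ε : ℂ), (0 : ℂ))},
          q ∈ immediateBasin (skewMap a) (0, 0) ∧
            ENNReal.ofReal C ≤ kobayashiDist (immediateBasin (skewMap a) (0, 0)) p q := by
  refine ⟨1 / (16 * (‖a‖ + 1)), by positivity, fun ε hε hε₀ C _ => ?_⟩
  obtain ⟨p, hp, hdist⟩ := theorem4p1_general a C.toNNReal
  refine ⟨p, hp, hdist _ ⟨⟨by norm_num, ?_⟩, fun h => h.1 rfl⟩⟩
  rw [lt_div_iff₀ (by positivity)] at hε₀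
  rw [Complex.norm_of_nonneg hε.le]
  linarith
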